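/- There is a constant $R_*>1$ such that for every $R_0\ge R_*$ the following holds with $\epsilon=\dfrac{1}{R_0^2\log R_0}$. There exist a bounded $C^\infty$ map $\mathbf U:\mathbb R^2\to\mathbb R^2$, a $C^\infty$ field $A=[A^{ij}_{\alpha\beta}]_{\alpha,\beta\le 2}^{i,j\le 2}$ on $\mathbb R^2$, a map $\mathbf u:\mathbb R^2\times(-\infty,0]\to\mathbb R^2$ and a coefficient field $a=[a^{ij}_{\alpha\beta}(x,t)]$ on $\mathbb R^2\times(-\infty,0]$ such that: 1. For all $x\in\mathbb R^2$ and $t<0$, $$\mathbf u(x,t)=(-t)^{-\epsilon/2}\,\mathbf U\!\left(\frac{x}{\sqrt{-t}}\right),\qquad a(x,t)=A\!\left(\frac{x}{\sqrt{-t}}\right).$$ 2. $\mathbf u$ is $C^\infty$ on $\{t<0\}$ and Lipschitz up to $t=0$ away from $(0,0)$: it is Lipschitz on $\mathbb R^2\times(-\infty,0]$ minus any neighborhood of $(0,0)$. 3. $a$ is bounded, symmetric ($a^{ij}_{\alpha\beta}=a^{ji}_{\beta\alpha}$) and uniformly elliptic on $\mathbb R^2\times(-\infty,0]$: there are $\lambda,\Lambda>0$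 with $\lambda|p|^2\le a^{ij}_{\alpha\beta}(x,t)p^\alpha_ip^\beta_j\le\Lambda|p|^2$ for all $(x,t)$ and all $p\in M^{2\times2}$. It is $C^\infty$ on $\{t<0\}$ and is discontinuous at $(0,0)$ (it has no limit there along $t<0$). 4. $\mathbf u$ is a weak solution of $\mathbf u_t=\operatorname{div}(a(x,t)D\mathbf u)$ in $\mathbb R^2\times(-\infty,0)$, that is, $\mathbf u,\,D\mathbf u\in L^2_{loc}(\mathbb R^2\times(-\infty,0))$ and $u^\alpha_t=\partial_i(a^{ij}_{\alpha\beta}u^\beta_j)$ in the sense of distributions for $\alpha=1,2$. 5. $\|\mathbf u(\cdot,t)\|_{L^\infty(B_1)}$ blows up at the rate $(-t)^{-\epsilon/2}$: there are $c,C>0$ with $c(-t)^{-\epsilon/2}\le\|\mathbf u(\cdot,t)\|_{L^\infty(B_1)}\le C(-t)^{-\epsilon/2}$ for all $t\in[-1,0)$. 6. $\mathbf u(\cdot,0)$ is homogeneous of degree $-\epsilon$, i.e. $\mathbf u(sx,0)=s^{-\epsilon}\mathbf u(x,0)$ for all $x\ne0$, $s>0$, and is discontinuous at $0$ (it has no limit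 as $x\to0$). -/

import Mathlib

open Set Filter Topology MeasureTheory
open scoped ContDiff

namespace ParabolicSystem

/-- Space-time `ℝⁿ × ℝ`; a point is written `p = (x, t)`. -/
abbrev SpaceTime (n : ℕ) := EuclideanSpace ℝ (Fin n) × ℝ

/-- Coefficient tensors: `a α β i j` is `a^{ij}_{αβ}` with `α, β ≤ m` and `i, j ≤ n`. -/
abbrev Coeff (m n : ℕ) := Fin m → Fin m → Fin n → Fin n → ℝ

/-- The domain `ℝⁿ × (-∞, 0)`. -/
def past (n : ℕ) : Set (SpaceTime n) := {p | p.2 < 0}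

/-- The domain `ℝⁿ × (-∞, 0]`. -/
def closedPast (n : ℕ) : Set (SpaceTime n) := {p | p.2 ≤ 0}

/-- The quadratic form `a^{ij}_{αβ} ξ^α_i ξ^β_j` on `m × n` matrices `ξ`. -/
def quadForm {m n : ℕ} (b : Coeff m n) (ξ : Matrix (Fin m) (Fin n) ℝ) : ℝ :=
  ∑ α, ∑ β, ∑ i, ∑ j, b α β i j * ξ α i * ξ β j

/-- The tensor is a symmetric bilinear form on `m × n` matrices. -/
def IsSymmCoeff {m n : ℕ} (b : Coeff m n) : Prop :=
  ∀ α β i j, b α β i j = b β α j i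

/-- Uniform ellipticity on `S`: `lam |ξ|² ≤ a^{ij}_{αβ} ξ^α_i ξ^β_j ≤ Lam |ξ|²` with positive constants
`lam`, `Lam` and the Euclidean norm of the matrix `ξ`. -/
def UniformlyElliptic {m n : ℕ} {X : Type*} (a : X → Coeff m n) (S : Set X) : Prop :=
  ∃ lam Lam : ℝ, 0 < lam ∧ 0 < Lam ∧ ∀ p ∈ S, ∀ ξ : Matrix (Fin m) (Fin n) ℝ,
    lam * (∑ α, ∑ i, ξ α i ^ 2) ≤ quadForm (a p) ξ ∧
      quadForm (a p) ξ ≤ Lam * (∑ α, ∑ i, ξ α i ^ 2)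

/-- The spatial partial derivative `∂ᵢ f`. -/
noncomputable def spaceDeriv {n : ℕ} (i : Fin n) (f : SpaceTime n → ℝ) (p : SpaceTime n) : ℝ :=
  fderiv ℝ f p (EuclideanSpace.single i 1, 0)

/-- The time derivative `∂ₜ f`. -/
noncomputable def timeDeriv {n : ℕ} (f : SpaceTime n → ℝ) (p : SpaceTime n) : ℝ :=
  fderiv ℝ f p (0, 1)

/-- Smooth real test functions with compact support in `ℝⁿ × (-∞, 0)`. -/
def IsTest {n : ℕ} (ζ : SpaceTime n → ℝ) : Prop :=
  ContDiff ℝ ∞ ζ ∧ HasCompactSupport ζ ∧ tsupport ζ ⊆ past n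

/-- `f ∈ L²_loc(ℝⁿ × (-∞, 0))`. -/
def MemL2Loc {n : ℕ} (f : SpaceTime n → ℝ) : Prop :=
  ∀ K : Set (SpaceTime n), IsCompact K → K ⊆ past n → MemLp f 2 (volume.restrict K)

/-- `G` is the weak spatial gradient of `u` on `ℝⁿ × (-∞, 0)`: `G p α i` is `∂ᵢ u^α`. -/
def IsWeakGradient {m n : ℕ} (u : SpaceTime n → EuclideanSpace ℝ (Fin m))
    (G : SpaceTime n → Matrix (Fin m) (Fin n) ℝ) : Prop :=
  ∀ ζ : SpaceTime n → ℝ, IsTest ζ → ∀ α i,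
    ∫ p, u p α * spaceDeriv i ζ p = -∫ p, G p α i * ζ p

/-- `u` is a weak solution of `u_t = div (a Du)` on `ℝⁿ × (-∞, 0)`: `u` and `Du` are in `L²_loc` and
`u^α_t = ∂ᵢ (a^{ij}_{αβ} ∂ⱼ u^β)` holds in the sense of distributions for every `α`. -/
def IsWeakSolution {m n : ℕ} (a : SpaceTime n → Coeff m n)
    (u : SpaceTime n → EuclideanSpace ℝ (Fin m)) : Prop :=
  (∀ α, MemL2Loc (fun p => u p α)) ∧
    ∃ G : SpaceTime n → Matrix (Fin m) (Fin n) ℝ,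
      (∀ α i, MemL2Loc (fun p => G p α i)) ∧ IsWeakGradient u G ∧
        ∀ ζ : SpaceTime n → ℝ, IsTest ζ → ∀ α,
          ∫ p, u p α * timeDeriv ζ p =
            ∫ p, ∑ β, ∑ i, ∑ j, a p α β i j * G p β j * spaceDeriv i ζ p

end ParabolicSystem

namespace ParabolicSystem

/-! ### Integration by parts on the past -/

/-! A radial field u = φ(|x|, t) x has a radial time derivative, hence u_t = ∇π for some pressure π,
and the system holds as soon as a Du = π I. Such an a can be written down pointwise. Let P be Du
divided by a positive scalar and choose k so that k tr P is π divided by the same scalar. The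
symmetric tensor k I ⊗ I + |P|² Id − P ⊗ P sends P to k (tr P) I (`pressureTensor_apply_self`). Its
quadratic form is k (tr ξ)² plus the Cauchy–Schwarz defect |P|²|ξ|² − (P : ξ)². The defect vanishes
only on multiples of P, where the trace does not, so the form is elliptic once k and tr P are
bounded below by positive constants (`le_quadForm_pressureTensor`).

It remains to find a profile for which both div u and π are positive. Put g = |x|² − t and σ = −t/g
∈ [0, 1]. For u = g^{-(1+ε)/2} (1 + κσ) x the pressure is g^{-(1+ε)/2} (κ/(1+ε) − 1/2 − κσ/2). It is
negative for κ = 0, while κ = 2 makes both quantities positive for 0 < ε ≤ 1/4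
(`le_trace_gradShape`, `le_pressureShape`); this range is all that is needed of ε.

Parabolic scaling leaves σ and a invariant and multiplies u by a power (`solution_smul`,
`coefficients_smul`). Self-similarity, the blow-up rate and both discontinuities follow. -/

theorem isOpen_past (n : ℕ) : IsOpen (past n) :=
  isOpen_lt continuous_snd continuous_const

theorem past_subset_closedPast (n : ℕ) : past n ⊆ closedPast n := fun p (hp : p.2 < 0) => hp.le

/-- The product of a function that is continuous on the past with a continuous function whose
support lies in a compact subset of the past is integrable. -/
theorem integrable_mul_of_continuousOn_past {n : ℕ} {f ψ : SpaceTime n → ℝ}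
    {K : Set (SpaceTime n)} (hf : ContinuousOn f (past n)) (hψ : Continuous ψ) (hK : IsCompact K)
    (hKp : K ⊆ past n) (hψK : ∀ p ∉ K, ψ p = 0) : Integrable fun p => f p * ψ p := by
  have hs : Function.support (fun p => f p * ψ p) ⊆ K := by
    intro p hp
    by_contra h
    exact hp (by simp [hψK p h])
  rw [← integrableOn_iff_integrable_of_support_subset hs]
  exact ((hf.mono hKp).mul hψ.continuousOn).integrableOn_compact hK

theorem IsTest.integrable_mul {n : ℕ} {f ζ : SpaceTime n → ℝ} (hζ : IsTest ζ)
    (hf : ContinuousOn f (past n)) : Integrable fun p => f p * ζ p :=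
  integrable_mul_of_continuousOn_past hf hζ.1.continuous hζ.2.1 hζ.2.2
    fun _ hp => image_eq_zero_of_notMem_tsupport hp

theorem IsTest.integrable_mul_fderiv {n : ℕ} {f ζ : SpaceTime n → ℝ} (hζ : IsTest ζ)
    (hf : ContinuousOn f (past n)) (v : SpaceTime n) :
    Integrable fun p => f p * fderiv ℝ ζ p v := by
  refine integrable_mul_of_continuousOn_past hf
    ((hζ.1.continuous_fderiv (by simp)).clm_apply continuous_const) hζ.2.1 hζ.2.2 fun p hp => ?_
  have h : fderiv ℝ ζ p = 0 := by
    by_contra h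
    exact hp (support_fderiv_subset ℝ h)
  simp [h]

/-- Integration by parts against a test function, for a function that is smooth on the past. -/
theorem IsTest.integral_mul_fderiv {n : ℕ} {f ζ : SpaceTime n → ℝ} (hζ : IsTest ζ)
    (hf : ContDiffOn ℝ ∞ f (past n)) {g : SpaceTime n → ℝ} {v : SpaceTime n}
    (hg : ∀ p ∈ past n, fderiv ℝ f p v = g p) :
    ∫ p, f p * fderiv ℝ ζ p v = -∫ p, g p * ζ p := by
  have hgf : (fun p => g p * ζ p) = fun p => fderiv ℝ f p v * ζ p := by
    funext p
    by_cases hp : p ∈ past n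
    · rw [hg p hp]
    · simp [image_eq_zero_of_notMem_tsupport fun h => hp (hζ.2.2 h)]
  rw [hgf]
  have : (volume : Measure (SpaceTime n)).IsAddHaarMeasure :=
    Measure.prod.instIsAddHaarMeasure volume volume
  refine integral_mul_fderiv_eq_neg_fderiv_mul_of_integrable ?_ ?_ ?_ ?_ ?_
  · exact hζ.integrable_mul
      ((hf.continuousOn_fderiv_of_isOpen (isOpen_past n) (by simp)).clm_apply continuousOn_const)
  · exact hζ.integrable_mul_fderiv hf.continuousOn v
  · exact hζ.integrable_mul hf.continuousOn
  · exact fun p hp => (hf.differentiableOn (by simp)).differentiableAt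
      ((isOpen_past n).mem_nhds (hζ.2.2 hp))
  · exact fun p _ => (hζ.1.differentiable (by simp)).differentiableAt

theorem memL2Loc_of_continuousOn {n : ℕ} {f : SpaceTime n → ℝ} (hf : ContinuousOn f (past n)) :
    MemL2Loc f := by
  intro K hK hKp
  obtain ⟨C, hC⟩ := hK.exists_bound_of_continuousOn (hf.mono hKp)
  have : IsFiniteMeasure (volume.restrict K) := ⟨by simpa using hK.measure_lt_top⟩
  exact MemLp.of_bound ((hf.mono hKp).aestronglyMeasurable hK.measurableSet) C
    (ae_restrict_of_forall_mem hK.measurableSet hC)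

/-! ### Tensors with a prescribed value at a given matrix -/

/-- The tensor `k I ⊗ I + |P|² Id - P ⊗ P`, which sends `P` to `k (tr P) I`. -/
def pressureTensor (k : ℝ) (P : Matrix (Fin 2) (Fin 2) ℝ) : Coeff 2 2 := fun α β i j =>
  k * ((1 : Matrix (Fin 2) (Fin 2) ℝ) α i * (1 : Matrix (Fin 2) (Fin 2) ℝ) β j)
    + (∑ γ, ∑ l, P γ l ^ 2)
      * ((1 : Matrix (Fin 2) (Fin 2) ℝ) α β * (1 : Matrix (Fin 2) (Fin 2) ℝ) i j)
    - P α i * P β j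

theorem isSymmCoeff_pressureTensor (k : ℝ) (P : Matrix (Fin 2) (Fin 2) ℝ) :
    IsSymmCoeff (pressureTensor k P) := by
  intro α β i j
  simp only [pressureTensor, Matrix.one_apply, eq_comm (a := β) (b := α),
    eq_comm (a := j) (b := i)]
  ring

theorem pressureTensor_apply_self (k : ℝ) (P : Matrix (Fin 2) (Fin 2) ℝ) (α i : Fin 2) :
    ∑ β, ∑ j, pressureTensor k P α β i j * P β j
      = k * P.trace * (1 : Matrix (Fin 2) (Fin 2) ℝ) α i := by
  fin_cases α <;> fin_cases i <;>
    simp [pressureTensor, Matrix.trace, Fin.sum_univ_two, Matrix.one_apply] <;> ring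

theorem quadForm_pressureTensor (k : ℝ) (P ξ : Matrix (Fin 2) (Fin 2) ℝ) :
    quadForm (pressureTensor k P) ξ = k * ξ.trace ^ 2
      + ((∑ γ, ∑ l, P γ l ^ 2) * (∑ γ, ∑ l, ξ γ l ^ 2) - (∑ γ, ∑ l, P γ l * ξ γ l) ^ 2) := by
  simp [quadForm, pressureTensor, Matrix.trace, Fin.sum_univ_two, Matrix.one_apply]
  ring

theorem trace_sq_le (ξ : Matrix (Fin 2) (Fin 2) ℝ) :
    ξ.trace ^ 2 ≤ 2 * ∑ γ, ∑ l, ξ γ l ^ 2 := by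
  simp only [Matrix.trace, Fin.sum_univ_two, Matrix.diag]
  nlinarith [sq_nonneg (ξ 0 0 - ξ 1 1), sq_nonneg (ξ 0 1), sq_nonneg (ξ 1 0)]

theorem frobenius_cauchy_schwarz (P ξ : Matrix (Fin 2) (Fin 2) ℝ) :
    (∑ γ, ∑ l, P γ l * ξ γ l) ^ 2 ≤ (∑ γ, ∑ l, P γ l ^ 2) * (∑ γ, ∑ l, ξ γ l ^ 2) := by
  simp only [← Fintype.sum_prod_type']
  exact Finset.sum_mul_sq_le_sq_mul_sq _ _ _

/-- A quantitative form of the dichotomy behind ellipticity: ξ is either transversal to P, and then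
the defect sees it, or nearly parallel to P, and then its trace is not small. With N = |P|² and c =
P : ξ, the matrix Nξ − cP is N times the part of ξ orthogonal to P, its squared norm is N times the
defect, and `trace_sq_le` is applied to it. -/
theorem frobenius_le_trace_add_defect (P ξ : Matrix (Fin 2) (Fin 2) ℝ) (hd : 1 / 2 ≤ P.trace) :
    (∑ γ, ∑ l, ξ γ l ^ 2) ≤ 8 * (∑ γ, ∑ l, P γ l ^ 2) * ξ.trace ^ 2
      + 24 * ((∑ γ, ∑ l, P γ l ^ 2) * (∑ γ, ∑ l, ξ γ l ^ 2)
        - (∑ γ, ∑ l, P γ l * ξ γ l) ^ 2) := by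
  have hcs := frobenius_cauchy_schwarz P ξ
  have htr := trace_sq_le P
  have key : ((∑ γ, ∑ l, P γ l ^ 2) * ξ.trace - (∑ γ, ∑ l, P γ l * ξ γ l) * P.trace) ^ 2
      ≤ 2 * ((∑ γ, ∑ l, P γ l ^ 2) * ((∑ γ, ∑ l, P γ l ^ 2) * (∑ γ, ∑ l, ξ γ l ^ 2)
        - (∑ γ, ∑ l, P γ l * ξ γ l) ^ 2)) := by
    have h := trace_sq_le ((∑ γ, ∑ l, P γ l ^ 2) • ξ - (∑ γ, ∑ l, P γ l * ξ γ l) • P)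
    refine le_trans (le_of_eq ?_) (h.trans (le_of_eq ?_))
    · simp [Matrix.trace_sub, Matrix.trace_smul]
    · simp only [Fin.sum_univ_two, Matrix.sub_apply, Matrix.smul_apply, smul_eq_mul]
      ring
  set N := ∑ γ, ∑ l, P γ l ^ 2
  set X := ∑ γ, ∑ l, ξ γ l ^ 2
  set c := ∑ γ, ∑ l, P γ l * ξ γ l
  set d := P.trace
  set t := ξ.trace
  have hN : 1 / 8 ≤ N := by nlinarith
  have hE : 0 ≤ N * X - c ^ 2 := by linarith
  -- This uses 2(Nt)² + 2(Nt − cd)² − (cd)² = (2Nt − cd)².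
  have h1 : c ^ 2 * d ^ 2 ≤ 2 * N ^ 2 * t ^ 2 + 4 * (N * (N * X - c ^ 2)) := by
    nlinarith [sq_nonneg (2 * N * t - c * d)]
  have h2 : c ^ 2 / 4 ≤ c ^ 2 * d ^ 2 := by
    have hd2 : 1 / 4 ≤ d ^ 2 := by nlinarith
    nlinarith [sq_nonneg c]
  -- NX is the defect E plus c². Here c² ≤ 8N²t² + 16NE, and N ≥ 1/8 gives E ≤ 8NE, whence 24 = 16 +
  -- 8.
  have h3 : N * X ≤ N * (8 * N * t ^ 2 + 24 * (N * X - c ^ 2)) := by nlinarith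
  exact le_of_mul_le_mul_left h3 (by linarith)

/-- The constant 480 = 8 · 60 combines the trace coefficient of `frobenius_le_trace_add_defect` with
the lower bound on k. -/
theorem le_quadForm_pressureTensor {k M : ℝ} {P : Matrix (Fin 2) (Fin 2) ℝ} (hk : 1 / 60 ≤ k)
    (hd : 1 / 2 ≤ P.trace) (hM : 1 ≤ M) (hP : ∑ γ, ∑ l, P γ l ^ 2 ≤ M)
    (ξ : Matrix (Fin 2) (Fin 2) ℝ) :
    1 / (480 * M) * (∑ γ, ∑ l, ξ γ l ^ 2) ≤ quadForm (pressureTensor k P) ξ := by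
  have h := frobenius_le_trace_add_defect P ξ hd
  have hE := frobenius_cauchy_schwarz P ξ
  rw [quadForm_pressureTensor]
  set N := ∑ γ, ∑ l, P γ l ^ 2
  set E := N * (∑ γ, ∑ l, ξ γ l ^ 2) - (∑ γ, ∑ l, P γ l * ξ γ l) ^ 2
  have hE0 : 0 ≤ E := by simp only [E]; linarith
  have ht := sq_nonneg ξ.trace
  have h1 : N * ξ.trace ^ 2 ≤ M * ξ.trace ^ 2 := by gcongr
  have h2 : 1 / 60 * ξ.trace ^ 2 ≤ k * ξ.trace ^ 2 := by gcongr
  have h3 : E ≤ M * E := by nlinarith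
  rw [one_div, inv_mul_le_iff₀ (by positivity)]
  nlinarith

theorem quadForm_pressureTensor_le {k M : ℝ} {P : Matrix (Fin 2) (Fin 2) ℝ} (hk : 0 ≤ k)
    (hP : ∑ γ, ∑ l, P γ l ^ 2 ≤ M) (ξ : Matrix (Fin 2) (Fin 2) ℝ) :
    quadForm (pressureTensor k P) ξ ≤ (2 * k + M) * (∑ γ, ∑ l, ξ γ l ^ 2) := by
  rw [quadForm_pressureTensor]
  have h := trace_sq_le ξ
  have hX : 0 ≤ ∑ γ, ∑ l, ξ γ l ^ 2 := by positivity
  nlinarith [mul_le_mul_of_nonneg_left h hk, mul_le_mul_of_nonneg_right hP hX,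
    sq_nonneg (∑ γ, ∑ l, P γ l * ξ γ l)]

theorem norm_pressureTensor_le {k : ℝ} {P : Matrix (Fin 2) (Fin 2) ℝ} {B : ℝ}
    (hP : ∀ α i, |P α i| ≤ B) : ‖pressureTensor k P‖ ≤ |k| + 5 * B ^ 2 := by
  have hB : 0 ≤ B := (abs_nonneg _).trans (hP 0 0)
  have hsq : ∀ α i, P α i ^ 2 ≤ B ^ 2 := fun α i => sq_le_sq' (abs_le.1 (hP α i)).1
    (abs_le.1 (hP α i)).2
  have h1 : ∀ α i, |(1 : Matrix (Fin 2) (Fin 2) ℝ) α i| ≤ 1 := by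
    intro α i
    rw [Matrix.one_apply]
    split_ifs <;> simp
  have hN : |∑ γ, ∑ l, P γ l ^ 2| ≤ 4 * B ^ 2 := by
    rw [abs_of_nonneg (by positivity)]
    simp only [Fin.sum_univ_two]
    linarith [hsq 0 0, hsq 0 1, hsq 1 0, hsq 1 1]
  have hC : 0 ≤ |k| + 5 * B ^ 2 := by positivity
  simp only [pi_norm_le_iff_of_nonneg hC, Real.norm_eq_abs]
  intro α β i j
  refine (abs_sub _ _).trans ((add_le_add (abs_add_le _ _) le_rfl).trans ?_)
  simp only [abs_mul]
  have h2 : |k| * (|(1 : Matrix (Fin 2) (Fin 2) ℝ) α i| * |(1 : Matrix (Fin 2) (Fin 2) ℝ) β j|)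
      ≤ |k| * (1 * 1) := by gcongr <;> apply h1
  have h3 : |∑ γ, ∑ l, P γ l ^ 2|
      * (|(1 : Matrix (Fin 2) (Fin 2) ℝ) α β| * |(1 : Matrix (Fin 2) (Fin 2) ℝ) i j|)
      ≤ 4 * B ^ 2 * (1 * 1) := by gcongr <;> apply h1
  have h4 : |P α i| * |P β j| ≤ B * B := by gcongr <;> apply hP
  nlinarith

/-! ### The explicit solution and its coefficients -/

/-- the parabolic gauge `|x|² - t`. -/
noncomputable def paraGauge (p : SpaceTime 2) : ℝ := ‖p.1‖ ^ 2 - p.2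

/-- The scale-invariant time `-t / (|x|² - t)`. -/
noncomputable def relTime (p : SpaceTime 2) : ℝ := -p.2 / paraGauge p

/-- The power `(|x|² - t)^{-(1+ε)/2}`. -/
noncomputable def decay (ε : ℝ) (p : SpaceTime 2) : ℝ := paraGauge p ^ (-((1 + ε) / 2))

/-- The solution `(|x|² - t)^{-(1+ε)/2} (1 + 2 relTime) x`. -/
noncomputable def solution (ε : ℝ) (p : SpaceTime 2) : EuclideanSpace ℝ (Fin 2) :=
  (decay ε p * (1 + 2 * relTime p)) • p.1

/-- The spatial gradient of `solution`, divided by `decay`. -/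
noncomputable def gradShape (ε : ℝ) (p : SpaceTime 2) : Matrix (Fin 2) (Fin 2) ℝ := fun α i =>
  (1 + 2 * relTime p) * (1 : Matrix (Fin 2) (Fin 2) ℝ) α i
    - (1 + ε + 2 * (3 + ε) * relTime p) * (p.1 α * p.1 i / paraGauge p)

/-- The pressure divided by `decay`, where the time derivative of `solution` is the gradient of the
pressure. -/
noncomputable def pressureShape (ε : ℝ) (p : SpaceTime 2) : ℝ :=
  (3 - ε) / (2 * (1 + ε)) - relTime p

/-- The coefficients, which send the gradient of `solution` to the pressure times the identity. -/
noncomputable def coefficients (ε : ℝ) (p : SpaceTime 2) : Coeff 2 2 :=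
  pressureTensor (pressureShape ε p / (gradShape ε p).trace) (gradShape ε p)

/-! ### Bounds -/

theorem gauge_nonneg {p : SpaceTime 2} (hp : p ∈ closedPast 2) : 0 ≤ paraGauge p := by
  have h : p.2 ≤ 0 := hp
  unfold paraGauge
  nlinarith [sq_nonneg ‖p.1‖]

theorem gauge_pos {p : SpaceTime 2} (hp : p ∈ past 2) : 0 < paraGauge p := by
  have h : p.2 < 0 := hp
  unfold paraGauge
  nlinarith [sq_nonneg ‖p.1‖]

theorem relTime_nonneg {p : SpaceTime 2} (hp : p ∈ closedPast 2) : 0 ≤ relTime p :=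
  div_nonneg (neg_nonneg.2 hp) (gauge_nonneg hp)

/-- Equality holds away from the origin. At the origin division by zero makes both quotients 0, so
the bounds built on this inequality hold on all of `closedPast 2`. -/
theorem sq_norm_div_gauge_le {p : SpaceTime 2} (hp : p ∈ closedPast 2) :
    ‖p.1‖ ^ 2 / paraGauge p ≤ 1 - relTime p := by
  rcases (gauge_nonneg hp).eq_or_lt with h | h
  · simp [relTime, ← h]
  · rw [relTime, le_sub_iff_add_le, ← add_div, div_le_one h, paraGauge]
    linarith

theorem relTime_le_one {p : SpaceTime 2} (hp : p ∈ closedPast 2) : relTime p ≤ 1 := by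
  have h1 := sq_norm_div_gauge_le hp
  have h2 : 0 ≤ ‖p.1‖ ^ 2 / paraGauge p := div_nonneg (sq_nonneg _) (gauge_nonneg hp)
  linarith

theorem abs_coord_mul_coord_div_gauge_le {p : SpaceTime 2} (hp : p ∈ closedPast 2) (α i : Fin 2) :
    |p.1 α * p.1 i / paraGauge p| ≤ 1 := by
  have h1 := sq_norm_div_gauge_le hp
  have h2 := relTime_nonneg hp
  have h3 : |p.1 α| * |p.1 i| ≤ ‖p.1‖ * ‖p.1‖ := by
    gcongr <;> exact PiLp.norm_apply_le p.1 _
  rw [abs_div, abs_mul, abs_of_nonneg (gauge_nonneg hp)]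
  refine (div_le_div_of_nonneg_right h3 (gauge_nonneg hp)).trans ?_
  rw [← sq]
  linarith

theorem trace_gradShape (ε : ℝ) (p : SpaceTime 2) :
    (gradShape ε p).trace = 2 * (1 + 2 * relTime p)
      - (1 + ε + 2 * (3 + ε) * relTime p) * (‖p.1‖ ^ 2 / paraGauge p) := by
  simp only [Matrix.trace, Matrix.diag, gradShape, Matrix.one_apply_eq, Fin.sum_univ_two,
    EuclideanSpace.real_norm_sq_eq]
  ring

/-- With σ = `relTime p`, the bound |x|²/g ≤ 1 − σ reduces the claim to the quadratic (1 − ε) − (1 +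
ε)σ + (6 + 2ε)σ². -/
theorem le_trace_gradShape {ε : ℝ} (h0 : 0 < ε) (h1 : ε ≤ 1 / 4) {p : SpaceTime 2}
    (hp : p ∈ closedPast 2) : 1 / 2 ≤ (gradShape ε p).trace := by
  have hs := relTime_nonneg hp
  have hs1 := relTime_le_one hp
  rw [trace_gradShape]
  have h : (1 + ε + 2 * (3 + ε) * relTime p) * (‖p.1‖ ^ 2 / paraGauge p)
      ≤ (1 + ε + 2 * (3 + ε) * relTime p) * (1 - relTime p) :=
    mul_le_mul_of_nonneg_left (sq_norm_div_gauge_le hp) (by positivity)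
  -- The point 1/10 is close to the minimiser 5/48 of 3/4 − 5σ/4 + 6σ².
  nlinarith [sq_nonneg (relTime p - 1 / 10), mul_nonneg h0.le hs,
    mul_nonneg h0.le (sq_nonneg (relTime p)), mul_le_mul_of_nonneg_right h1 hs]

theorem trace_gradShape_le {ε : ℝ} (h0 : 0 < ε) {p : SpaceTime 2}
    (hp : p ∈ closedPast 2) : (gradShape ε p).trace ≤ 6 := by
  have hs := relTime_nonneg hp
  have hs1 := relTime_le_one hp
  rw [trace_gradShape]
  have h : 0 ≤ (1 + ε + 2 * (3 + ε) * relTime p) * (‖p.1‖ ^ 2 / paraGauge p) :=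
    mul_nonneg (by positivity) (div_nonneg (sq_nonneg _) (gauge_nonneg hp))
  linarith

/-- The worst case is σ = 1, ε = 1/4, where the value is exactly 11/10 − 1. -/
theorem le_pressureShape {ε : ℝ} (h0 : 0 < ε) (h1 : ε ≤ 1 / 4) {p : SpaceTime 2}
    (hp : p ∈ closedPast 2) : 1 / 10 ≤ pressureShape ε p := by
  have h : 11 / 10 ≤ (3 - ε) / (2 * (1 + ε)) := by
    rw [le_div_iff₀ (by positivity)]
    linarith
  have hs1 := relTime_le_one hp
  unfold pressureShape
  linarith

theorem pressureShape_le {ε : ℝ} (h0 : 0 < ε) {p : SpaceTime 2}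
    (hp : p ∈ closedPast 2) : pressureShape ε p ≤ 3 / 2 := by
  have h : (3 - ε) / (2 * (1 + ε)) ≤ 3 / 2 := by
    rw [div_le_iff₀ (by positivity)]
    linarith
  have hs := relTime_nonneg hp
  unfold pressureShape
  linarith

theorem le_pressureShape_div_trace {ε : ℝ} (h0 : 0 < ε) (h1 : ε ≤ 1 / 4) {p : SpaceTime 2}
    (hp : p ∈ closedPast 2) : 1 / 60 ≤ pressureShape ε p / (gradShape ε p).trace := by
  have h2 := le_trace_gradShape h0 h1 hp
  rw [le_div_iff₀ (by linarith)]
  linarith [trace_gradShape_le h0 hp, le_pressureShape h0 h1 hp]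

theorem pressureShape_div_trace_le {ε : ℝ} (h0 : 0 < ε) (h1 : ε ≤ 1 / 4) {p : SpaceTime 2}
    (hp : p ∈ closedPast 2) : pressureShape ε p / (gradShape ε p).trace ≤ 3 := by
  have h2 := le_trace_gradShape h0 h1 hp
  rw [div_le_iff₀ (by linarith)]
  linarith [pressureShape_le h0 hp]

/-- The two terms are at most 3 and 1 + 1/4 + 13/2, which sum to less than 11. -/
theorem abs_gradShape_le {ε : ℝ} (h0 : 0 < ε) (h1 : ε ≤ 1 / 4) {p : SpaceTime 2}
    (hp : p ∈ closedPast 2) (α i : Fin 2) : |gradShape ε p α i| ≤ 11 := by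
  have hs := relTime_nonneg hp
  have hs1 := relTime_le_one hp
  have hc := abs_coord_mul_coord_div_gauge_le hp α i
  have hδ : |(1 : Matrix (Fin 2) (Fin 2) ℝ) α i| ≤ 1 := by
    rw [Matrix.one_apply]
    split_ifs <;> simp
  have hA : 0 ≤ 1 + 2 * relTime p := by positivity
  have hB : 0 ≤ 1 + ε + 2 * (3 + ε) * relTime p := by positivity
  refine (abs_sub _ _).trans ?_
  rw [abs_mul, abs_mul, abs_of_nonneg hA, abs_of_nonneg hB]
  nlinarith [mul_le_mul_of_nonneg_left hδ hA, mul_le_mul_of_nonneg_left hc hB]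

theorem sum_sq_gradShape_le {ε : ℝ} (h0 : 0 < ε) (h1 : ε ≤ 1 / 4) {p : SpaceTime 2}
    (hp : p ∈ closedPast 2) : ∑ α, ∑ i, gradShape ε p α i ^ 2 ≤ 484 := by
  have h : ∀ α i, gradShape ε p α i ^ 2 ≤ 11 ^ 2 := fun α i =>
    sq_le_sq' (abs_le.1 (abs_gradShape_le h0 h1 hp α i)).1
      (abs_le.1 (abs_gradShape_le h0 h1 hp α i)).2
  simp only [Fin.sum_univ_two]
  linarith [h 0 0, h 0 1, h 1 0, h 1 1]

theorem uniformlyElliptic_coefficients {ε : ℝ} (h0 : 0 < ε) (h1 : ε ≤ 1 / 4) :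
    UniformlyElliptic (coefficients ε) (closedPast 2) := by
  refine ⟨1 / (480 * 484), 2 * 3 + 484, by norm_num, by norm_num, fun p hp ξ => ⟨?_, ?_⟩⟩
  · exact le_quadForm_pressureTensor (le_pressureShape_div_trace h0 h1 hp)
      (le_trace_gradShape h0 h1 hp) (by norm_num) (sum_sq_gradShape_le h0 h1 hp) ξ
  · have hk := le_pressureShape_div_trace h0 h1 hp
    refine (quadForm_pressureTensor_le (by linarith) (sum_sq_gradShape_le h0 h1 hp) ξ).trans ?_
    gcongr
    exact pressureShape_div_trace_le h0 h1 hp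

theorem norm_coefficients_le {ε : ℝ} (h0 : 0 < ε) (h1 : ε ≤ 1 / 4) {p : SpaceTime 2}
    (hp : p ∈ closedPast 2) : ‖coefficients ε p‖ ≤ 3 + 5 * 11 ^ 2 := by
  have hk := le_pressureShape_div_trace h0 h1 hp
  refine (norm_pressureTensor_le (abs_gradShape_le h0 h1 hp)).trans ?_
  rw [abs_of_nonneg (by linarith)]
  linarith [pressureShape_div_trace_le h0 h1 hp]

theorem norm_solution_le {ε : ℝ} {p : SpaceTime 2} (hp : p ∈ closedPast 2) (hg : 0 < paraGauge p) :
    ‖solution ε p‖ ≤ 3 * paraGauge p ^ (-(ε / 2)) := by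
  have hs := relTime_nonneg hp
  have hs1 := relTime_le_one hp
  have hx : ‖p.1‖ ≤ paraGauge p ^ (1 / 2 : ℝ) := by
    rw [← Real.sqrt_eq_rpow]
    refine Real.le_sqrt_of_sq_le ?_
    have h : p.2 ≤ 0 := hp
    unfold paraGauge
    linarith
  have hd : 0 < decay ε p := Real.rpow_pos_of_pos hg _
  rw [solution, norm_smul, Real.norm_eq_abs, abs_of_nonneg (by positivity)]
  have hpow : paraGauge p ^ (-(ε / 2)) = decay ε p * paraGauge p ^ (1 / 2 : ℝ) := by
    rw [decay, ← Real.rpow_add hg]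
    congr 1
    ring
  rw [hpow]
  calc decay ε p * (1 + 2 * relTime p) * ‖p.1‖
      ≤ decay ε p * (1 + 2 * 1) * paraGauge p ^ (1 / 2 : ℝ) := by gcongr
    _ = 3 * (decay ε p * paraGauge p ^ (1 / 2 : ℝ)) := by ring

/-! ### Scaling -/

theorem gauge_smul (l : ℝ) (p : SpaceTime 2) :
    paraGauge (l • p.1, l ^ 2 * p.2) = l ^ 2 * paraGauge p := by
  simp only [paraGauge, norm_smul, mul_pow, Real.norm_eq_abs, sq_abs]
  ring

theorem relTime_smul {l : ℝ} (hl : 0 < l) (p : SpaceTime 2) :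
    relTime (l • p.1, l ^ 2 * p.2) = relTime p := by
  rw [relTime, gauge_smul, ← mul_neg, mul_div_mul_left _ _ (by positivity), relTime]

theorem coefficients_smul (ε : ℝ) {l : ℝ} (hl : 0 < l) (p : SpaceTime 2) :
    coefficients ε (l • p.1, l ^ 2 * p.2) = coefficients ε p := by
  have h : gradShape ε (l • p.1, l ^ 2 * p.2) = gradShape ε p := by
    funext α i
    simp only [gradShape, relTime_smul hl, gauge_smul, PiLp.smul_apply, smul_eq_mul]
    rw [show l * p.1 α * (l * p.1 i) = l ^ 2 * (p.1 α * p.1 i) by ring,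
      mul_div_mul_left _ _ (by positivity)]
  simp only [coefficients, h, pressureShape, relTime_smul hl]

theorem solution_smul (ε : ℝ) {l : ℝ} (hl : 0 < l) {p : SpaceTime 2} (hp : p ∈ closedPast 2) :
    solution ε (l • p.1, l ^ 2 * p.2) = (l ^ (-ε) : ℝ) • solution ε p := by
  have h : decay ε (l • p.1, l ^ 2 * p.2) * l = l ^ (-ε) * decay ε p := by
    rw [decay, gauge_smul, Real.mul_rpow (by positivity) (gauge_nonneg hp), ← Real.rpow_natCast,
      ← Real.rpow_mul hl.le, decay, mul_right_comm]
    nth_rewrite 2 [← Real.rpow_one l]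
    rw [← Real.rpow_add hl]
    congr 2
    push_cast
    ring
  simp only [solution, relTime_smul hl, smul_smul]
  congr 1
  linear_combination (1 + 2 * relTime p) * h

/-- Every point of the past is a parabolic dilate, by √(-t), of a point on the slice t = -1. -/
theorem exists_scale {t : ℝ} (ht : t < 0) (x : EuclideanSpace ℝ (Fin 2)) :
    (x, t) = (√(-t) • ((√(-t))⁻¹ • x), √(-t) ^ 2 * (-1)) := by
  have h : √(-t) ≠ 0 := (Real.sqrt_pos.2 (by linarith)).ne'
  rw [smul_inv_smul₀ h, Real.sq_sqrt (by linarith)]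
  simp

theorem mk_neg_one_mem_past (y : EuclideanSpace ℝ (Fin 2)) : (y, (-1 : ℝ)) ∈ past 2 :=
  show (-1 : ℝ) < 0 by norm_num

theorem solution_selfSimilar (ε : ℝ) {t : ℝ} (ht : t < 0) (x : EuclideanSpace ℝ (Fin 2)) :
    solution ε (x, t) = ((-t) ^ (-(ε / 2)) : ℝ) • solution ε ((√(-t))⁻¹ • x, -1) := by
  have h := solution_smul ε (Real.sqrt_pos.2 (neg_pos.2 ht))
    (past_subset_closedPast 2 (mk_neg_one_mem_past ((√(-t))⁻¹ • x)))
  rw [← exists_scale ht] at h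
  rw [h, Real.sqrt_eq_rpow, ← Real.rpow_mul (by linarith)]
  congr 2
  ring

theorem coefficients_selfSimilar (ε : ℝ) {t : ℝ} (ht : t < 0) (x : EuclideanSpace ℝ (Fin 2)) :
    coefficients ε (x, t) = coefficients ε ((√(-t))⁻¹ • x, -1) := by
  have h := coefficients_smul ε (Real.sqrt_pos.2 (neg_pos.2 ht)) ((√(-t))⁻¹ • x, -1)
  rwa [← exists_scale ht] at h

/-! ### Smoothness -/

theorem contDiff_gauge : ContDiff ℝ ∞ paraGauge :=
  (contDiff_fst.norm_sq ℝ).sub contDiff_snd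

theorem contDiffOn_relTime : ContDiffOn ℝ ∞ relTime {p | 0 < paraGauge p} :=
  contDiff_snd.neg.contDiffOn.div contDiff_gauge.contDiffOn fun _ hp => ne_of_gt hp

theorem contDiffOn_decay (ε : ℝ) : ContDiffOn ℝ ∞ (decay ε) {p | 0 < paraGauge p} :=
  contDiff_gauge.contDiffOn.rpow_const_of_ne fun _ hp => ne_of_gt hp

theorem contDiffOn_solution (ε : ℝ) : ContDiffOn ℝ ∞ (solution ε) {p | 0 < paraGauge p} :=
  ((contDiffOn_decay ε).mul
    (contDiffOn_const.add (contDiffOn_const.mul contDiffOn_relTime))).smul contDiff_fst.contDiffOn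

theorem contDiff_coord (i : Fin 2) : ContDiff ℝ ∞ fun p : SpaceTime 2 => p.1 i :=
  (contDiff_euclidean.1 contDiff_fst) i

theorem contDiffOn_gradShape (ε : ℝ) (α i : Fin 2) :
    ContDiffOn ℝ ∞ (fun p => gradShape ε p α i) {p | 0 < paraGauge p} := by
  refine ((contDiffOn_const.add (contDiffOn_const.mul contDiffOn_relTime)).mul
    contDiffOn_const).sub ((contDiffOn_const.add (contDiffOn_const.mul contDiffOn_relTime)).mul ?_)
  exact ((contDiff_coord α).mul (contDiff_coord i)).contDiffOn.div contDiff_gauge.contDiffOn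
    fun _ hp => ne_of_gt hp

theorem contDiffOn_pressureShape (ε : ℝ) :
    ContDiffOn ℝ ∞ (pressureShape ε) {p | 0 < paraGauge p} :=
  contDiffOn_const.sub contDiffOn_relTime

theorem past_subset_gauge_pos : past 2 ⊆ {p | 0 < paraGauge p} := fun _ hp => gauge_pos hp

theorem contDiffOn_coefficients {ε : ℝ} (h0 : 0 < ε) (h1 : ε ≤ 1 / 4) :
    ContDiffOn ℝ ∞ (coefficients ε) (past 2) := by
  have hP : ∀ α i, ContDiffOn ℝ ∞ (fun p => gradShape ε p α i) (past 2) := fun α i =>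
    (contDiffOn_gradShape ε α i).mono past_subset_gauge_pos
  have hT : ContDiffOn ℝ ∞ (fun p => (gradShape ε p).trace) (past 2) :=
    ContDiffOn.sum fun i _ => hP i i
  have hk := ((contDiffOn_pressureShape ε).mono past_subset_gauge_pos).div hT fun p hp =>
    (show (gradShape ε p).trace ≠ 0 by
      linarith [le_trace_gradShape h0 h1 (past_subset_closedPast 2 hp)])
  simp only [contDiffOn_pi]
  intro α β i j
  exact ((hk.mul contDiffOn_const).add
    ((ContDiffOn.sum fun γ _ => ContDiffOn.sum fun l _ => (hP γ l).pow 2).mul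
      contDiffOn_const)).sub ((hP α i).mul (hP β j))

/-! ### Derivatives -/

/-- The derivative of `paraGauge`. -/
noncomputable def gaugeDeriv (p : SpaceTime 2) : SpaceTime 2 →L[ℝ] ℝ :=
  2 • (innerSL ℝ p.1).comp (ContinuousLinearMap.fst ℝ _ _) - ContinuousLinearMap.snd ℝ _ _

theorem gaugeDeriv_apply (p v : SpaceTime 2) : gaugeDeriv p v = 2 * inner ℝ p.1 v.1 - v.2 := by
  simp [gaugeDeriv]

theorem hasFDerivAt_gauge (p : SpaceTime 2) : HasFDerivAt paraGauge (gaugeDeriv p) p :=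
  hasFDerivAt_fst.norm_sq.sub hasFDerivAt_snd

theorem norm_gaugeDeriv_le (p : SpaceTime 2) : ‖gaugeDeriv p‖ ≤ 2 * ‖p.1‖ + 1 := by
  refine ContinuousLinearMap.opNorm_le_bound _ (by positivity) fun v => ?_
  rw [gaugeDeriv_apply, Real.norm_eq_abs]
  have h1 : |inner ℝ p.1 v.1| ≤ ‖p.1‖ * ‖v‖ :=
    (abs_real_inner_le_norm _ _).trans (by gcongr; exact norm_fst_le v)
  have h2 : |v.2| ≤ ‖v‖ := norm_snd_le v
  refine (abs_sub _ _).trans ?_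
  rw [abs_mul, abs_two]
  linarith

theorem hasFDerivAt_relTime {p : SpaceTime 2} (hp : 0 < paraGauge p) :
    HasFDerivAt relTime
      (-(paraGauge p)⁻¹ • (ContinuousLinearMap.snd ℝ _ _ + relTime p • gaugeDeriv p)) p := by
  have h := (hasFDerivAt_snd (𝕜 := ℝ) (p := p)).neg.fun_mul
    ((hasDerivAt_inv hp.ne').comp_hasFDerivAt p (hasFDerivAt_gauge p))
  refine (h.congr_fderiv ?_).congr_of_eventuallyEq (.of_forall fun q => ?_)
  · ext v
    · simp [relTime]
      field_simp
    · simp [relTime]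
      field_simp
      ring
  · simp [relTime, div_eq_mul_inv]

theorem hasFDerivAt_decay (ε : ℝ) {p : SpaceTime 2} (hp : 0 < paraGauge p) :
    HasFDerivAt (decay ε) ((-((1 + ε) / 2) * (decay ε p / paraGauge p)) • gaugeDeriv p) p := by
  have h := (hasFDerivAt_gauge p).rpow_const (p := -((1 + ε) / 2)) (Or.inl hp.ne')
  rwa [Real.rpow_sub_one hp.ne'] at h

/-- The derivative of the scalar factor of `solution`. -/
noncomputable def factorDeriv (ε : ℝ) (p : SpaceTime 2) : SpaceTime 2 →L[ℝ] ℝ :=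
  -(decay ε p / paraGauge p) • ((2 : ℝ) • ContinuousLinearMap.snd ℝ _ _
    + ((1 + ε) / 2 + (3 + ε) * relTime p) • gaugeDeriv p)

theorem hasFDerivAt_factor (ε : ℝ) {p : SpaceTime 2} (hp : 0 < paraGauge p) :
    HasFDerivAt (fun p => decay ε p * (1 + 2 * relTime p)) (factorDeriv ε p) p := by
  have h := (hasFDerivAt_decay ε hp).fun_mul
    (((hasFDerivAt_relTime hp).const_mul 2).const_add 1)
  refine h.congr_fderiv ?_
  ext v <;> simp [factorDeriv] <;> field_simp <;> ring

/-- Positivity of the gauge is an open condition that includes t = 0, x ≠ 0, so this is a full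
derivative there and yields Lipschitz bounds up to the final time. -/
theorem hasFDerivAt_solution (ε : ℝ) {p : SpaceTime 2} (hp : 0 < paraGauge p) :
    HasFDerivAt (solution ε) ((decay ε p * (1 + 2 * relTime p)) • ContinuousLinearMap.fst ℝ _ _
      + (factorDeriv ε p).smulRight p.1) p :=
  (hasFDerivAt_factor ε hp).smul hasFDerivAt_fst

theorem hasFDerivAt_coord (i : Fin 2) (p : SpaceTime 2) :
    HasFDerivAt (fun p : SpaceTime 2 => p.1 i)
      ((EuclideanSpace.proj i).comp (ContinuousLinearMap.fst ℝ _ _)) p :=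
  ((EuclideanSpace.proj i : EuclideanSpace ℝ (Fin 2) →L[ℝ] ℝ).hasFDerivAt).comp p hasFDerivAt_fst

theorem fderiv_solution_coord (ε : ℝ) {p : SpaceTime 2} (hp : 0 < paraGauge p) (α : Fin 2)
    (v : SpaceTime 2) : fderiv ℝ (fun p => solution ε p α) p v
      = decay ε p * (1 + 2 * relTime p) * v.1 α + factorDeriv ε p v * p.1 α := by
  have h := (hasFDerivAt_factor ε hp).fun_mul (hasFDerivAt_coord α p)
  have h' : HasFDerivAt (fun p => solution ε p α) _ p := h
  rw [h'.fderiv]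
  simp
  ring

theorem inner_single (x : EuclideanSpace ℝ (Fin 2)) (i : Fin 2) :
    inner ℝ x (EuclideanSpace.single i (1 : ℝ)) = x i := by
  simp [EuclideanSpace.inner_single_right]

theorem spaceDeriv_solution (ε : ℝ) {p : SpaceTime 2} (hp : 0 < paraGauge p) (α i : Fin 2) :
    spaceDeriv i (fun p => solution ε p α) p = decay ε p * gradShape ε p α i := by
  rw [spaceDeriv, fderiv_solution_coord ε hp]
  simp only [factorDeriv, smul_apply, add_apply,
    gaugeDeriv_apply, inner_single, ContinuousLinearMap.coe_snd', smul_eq_mul, gradShape,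
    Matrix.one_apply, PiLp.single_apply]
  split_ifs <;> field_simp <;> ring

theorem timeDeriv_solution (ε : ℝ) {p : SpaceTime 2} (hp : 0 < paraGauge p) (α : Fin 2) :
    timeDeriv (fun p => solution ε p α) p
      = decay ε p / paraGauge p * ((ε - 3) / 2 + (3 + ε) * relTime p) * p.1 α := by
  rw [timeDeriv, fderiv_solution_coord ε hp]
  simp only [factorDeriv, smul_apply, add_apply, gaugeDeriv_apply, ContinuousLinearMap.coe_snd',
    inner_zero_right, PiLp.zero_apply, smul_eq_mul]
  ring

theorem contDiffOn_pressure (ε : ℝ) :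
    ContDiffOn ℝ ∞ (fun p => decay ε p * pressureShape ε p) (past 2) :=
  ((contDiffOn_decay ε).mul (contDiffOn_pressureShape ε)).mono past_subset_gauge_pos

/-- The right-hand side is that of `timeDeriv_solution`. The constant (3 − ε)/(2(1 + ε)) in
`pressureShape` is the one that makes the terms free of `relTime` agree. -/
theorem spaceDeriv_pressure {ε : ℝ} (h0 : 0 < ε) {p : SpaceTime 2} (hp : 0 < paraGauge p)
    (i : Fin 2) : spaceDeriv i (fun p => decay ε p * pressureShape ε p) p
      = decay ε p / paraGauge p * ((ε - 3) / 2 + (3 + ε) * relTime p) * p.1 i := by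
  have h := (hasFDerivAt_decay ε hp).fun_mul
    ((hasFDerivAt_relTime hp).const_sub ((3 - ε) / (2 * (1 + ε))))
  have h' : HasFDerivAt (fun p => decay ε p * pressureShape ε p) _ p := h
  rw [spaceDeriv, h'.fderiv]
  have h1 : 1 + ε ≠ 0 := by positivity
  simp [gaugeDeriv_apply, EuclideanSpace.inner_single_right]
  field_simp
  ring

/-! ### The weak formulation -/

/-- The flux a Du collapses to π I, so after integrating by parts in t on one side and in x_α on the
other, the equation is the pointwise identity ∂ₜu^α = ∂_α π. -/
theorem isWeakSolution_solution {ε : ℝ} (h0 : 0 < ε) (h1 : ε ≤ 1 / 4) :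
    IsWeakSolution (coefficients ε) (solution ε) := by
  have hu : ∀ α, ContDiffOn ℝ ∞ (fun p => solution ε p α) (past 2) :=
    contDiffOn_euclidean.1 ((contDiffOn_solution ε).mono past_subset_gauge_pos)
  have hG : ∀ α i, ContDiffOn ℝ ∞ (fun p => decay ε p * gradShape ε p α i) (past 2) :=
    fun α i => ((contDiffOn_decay ε).mul (contDiffOn_gradShape ε α i)).mono past_subset_gauge_pos
  refine ⟨fun α => memL2Loc_of_continuousOn (hu α).continuousOn,
    fun p α i => decay ε p * gradShape ε p α i,
    fun α i => memL2Loc_of_continuousOn (hG α i).continuousOn, fun ζ hζ α i => ?_,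
    fun ζ hζ α => ?_⟩
  · exact hζ.integral_mul_fderiv (hu α) fun p hp => spaceDeriv_solution ε (gauge_pos hp) α i
  · have hflux : ∀ p, ∑ β, ∑ i, ∑ j,
        coefficients ε p α β i j * (decay ε p * gradShape ε p β j) * spaceDeriv i ζ p
        = decay ε p * pressureShape ε p * spaceDeriv α ζ p := by
      intro p
      by_cases hp : p ∈ past 2
      · have ht : (gradShape ε p).trace ≠ 0 := by
          linarith [le_trace_gradShape h0 h1 (past_subset_closedPast 2 hp)]
        have hA : ∀ i, ∑ β, ∑ j, coefficients ε p α β i j * gradShape ε p β j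
            = pressureShape ε p * (1 : Matrix (Fin 2) (Fin 2) ℝ) α i := fun i => by
          rw [coefficients, pressureTensor_apply_self, div_mul_cancel₀ _ ht]
        rw [Finset.sum_comm]
        have hi : ∀ i, ∑ β, ∑ j,
            coefficients ε p α β i j * (decay ε p * gradShape ε p β j) * spaceDeriv i ζ p
            = decay ε p * (∑ β, ∑ j, coefficients ε p α β i j * gradShape ε p β j)
              * spaceDeriv i ζ p := fun i => by
          simp only [Finset.mul_sum, Finset.sum_mul]
          exact Finset.sum_congr rfl fun β _ => Finset.sum_congr rfl fun j _ => by ring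
        simp only [hi, hA, Matrix.one_apply]
        simp
      · have hζ0 : ∀ i, spaceDeriv i ζ p = 0 := by
          intro i
          have h : fderiv ℝ ζ p = 0 := by
            by_contra h
            exact hp (hζ.2.2 (support_fderiv_subset ℝ h))
          simp [spaceDeriv, h]
        simp [hζ0]
    simp only [hflux]
    have ht := hζ.integral_mul_fderiv (hu α) (v := (0, 1))
      fun p hp => timeDeriv_solution ε (gauge_pos hp) α
    have hx := hζ.integral_mul_fderiv (contDiffOn_pressure ε)
      (v := (EuclideanSpace.single α 1, 0))
      fun p hp => spaceDeriv_pressure h0 (gauge_pos hp) α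
    exact ht.trans hx.symm

/-! ### Lipschitz bounds away from the origin -/

theorem norm_factorDeriv_le {ε : ℝ} (h0 : 0 < ε) (h1 : ε ≤ 1 / 4) {p : SpaceTime 2}
    (hp : p ∈ closedPast 2) (hg : 0 < paraGauge p) :
    ‖factorDeriv ε p‖ ≤ decay ε p / paraGauge p * (6 + 8 * ‖p.1‖) := by
  have hs := relTime_nonneg hp
  have hs1 := relTime_le_one hp
  have hd : 0 < decay ε p := Real.rpow_pos_of_pos hg _
  have hsnd : ‖ContinuousLinearMap.snd ℝ (EuclideanSpace ℝ (Fin 2)) ℝ‖ ≤ 1 :=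
    ContinuousLinearMap.norm_snd_le ..
  have hc0 : 0 ≤ (1 + ε) / 2 + (3 + ε) * relTime p := by positivity
  have hc : (1 + ε) / 2 + (3 + ε) * relTime p ≤ 4 := by nlinarith
  rw [factorDeriv, norm_smul, norm_neg, Real.norm_eq_abs, abs_of_nonneg (by positivity)]
  gcongr
  refine (norm_add_le _ _).trans ?_
  rw [norm_smul, norm_smul, Real.norm_two, Real.norm_eq_abs, abs_of_nonneg hc0]
  have h := mul_le_mul hc (norm_gaugeDeriv_le p) (norm_nonneg _) (by norm_num)
  linarith

/-- The derivative of `solution` is bounded where the gauge is bounded below. -/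
theorem norm_fderiv_solution_le {ε w : ℝ} (h0 : 0 < ε) (h1 : ε ≤ 1 / 4) (hw : 0 < w)
    {p : SpaceTime 2} (hp : p ∈ closedPast 2) (hg : w ≤ paraGauge p) :
    ‖(decay ε p * (1 + 2 * relTime p)) • ContinuousLinearMap.fst ℝ _ _
      + (factorDeriv ε p).smulRight p.1‖ ≤ w ^ (-((1 + ε) / 2)) * (17 + 14 / w) := by
  have hg0 : 0 < paraGauge p := hw.trans_le hg
  have hs := relTime_nonneg hp
  have hs1 := relTime_le_one hp
  have hd : 0 < decay ε p := Real.rpow_pos_of_pos hg0 _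
  have hdw : decay ε p ≤ w ^ (-((1 + ε) / 2)) :=
    Real.rpow_le_rpow_of_nonpos hw hg (by linarith)
  have hfst : ‖ContinuousLinearMap.fst ℝ (EuclideanSpace ℝ (Fin 2)) ℝ‖ ≤ 1 :=
    ContinuousLinearMap.norm_fst_le ..
  have hx2 : ‖p.1‖ ^ 2 ≤ paraGauge p := by
    have h : p.2 ≤ 0 := hp
    unfold paraGauge
    linarith
  have hx : (6 + 8 * ‖p.1‖) * ‖p.1‖ ≤ 14 * paraGauge p + 14 := by
    nlinarith [sq_nonneg (‖p.1‖ - 1)]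
  have hD : ‖factorDeriv ε p‖ * ‖p.1‖ ≤ decay ε p * (14 + 14 / paraGauge p) := by
    calc ‖factorDeriv ε p‖ * ‖p.1‖
        ≤ decay ε p / paraGauge p * (6 + 8 * ‖p.1‖) * ‖p.1‖ := by
          gcongr
          exact norm_factorDeriv_le h0 h1 hp hg0
      _ = decay ε p / paraGauge p * ((6 + 8 * ‖p.1‖) * ‖p.1‖) := by ring
      _ ≤ decay ε p / paraGauge p * (14 * paraGauge p + 14) := by gcongr
      _ = decay ε p * (14 + 14 / paraGauge p) := by field_simp
  have hF : ‖(decay ε p * (1 + 2 * relTime p)) •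
      ContinuousLinearMap.fst ℝ (EuclideanSpace ℝ (Fin 2)) ℝ‖ ≤ decay ε p * 3 := by
    rw [norm_smul, Real.norm_eq_abs, abs_of_nonneg (by positivity)]
    calc decay ε p * (1 + 2 * relTime p) * ‖ContinuousLinearMap.fst ℝ (EuclideanSpace ℝ (Fin 2)) ℝ‖
        ≤ decay ε p * (1 + 2 * 1) * 1 := by gcongr
      _ = decay ε p * 3 := by ring
  refine (norm_add_le _ _).trans ?_
  rw [ContinuousLinearMap.norm_smulRight_apply]
  calc _ ≤ decay ε p * 3 + decay ε p * (14 + 14 / paraGauge p) := add_le_add hF hD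
    _ = decay ε p * (17 + 14 / paraGauge p) := by ring
    _ ≤ w ^ (-((1 + ε) / 2)) * (17 + 14 / w) := by gcongr

/-- The product carries the sup norm, so either |x| ≥ δ or −t ≥ δ. -/
theorem le_gauge_of_le_norm {δ : ℝ} (hδ : 0 < δ) {p : SpaceTime 2} (hp : p ∈ closedPast 2)
    (h : δ ≤ ‖p‖) : min (δ ^ 2) δ ≤ paraGauge p := by
  have ht : p.2 ≤ 0 := hp
  rw [Prod.norm_def, le_max_iff, Real.norm_eq_abs, abs_of_nonpos ht] at h
  unfold paraGauge
  rcases h with h | h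
  · have := pow_le_pow_left₀ hδ.le h 2
    exact (min_le_left _ _).trans (by linarith)
  · exact (min_le_right _ _).trans (by nlinarith [sq_nonneg ‖p.1‖])

theorem convex_closedPast (n : ℕ) : Convex ℝ (closedPast n) :=
  convex_halfSpace_le (LinearMap.snd ℝ _ ℝ).isLinear 0

/-- A bounded function with bounded derivative outside each ball around the origin, within a convex
set, is Lipschitz outside each ball. -/
theorem exists_lipschitzOnWith_of_bounds {E F : Type*} [NormedAddCommGroup E] [NormedSpace ℝ E]
    [NormedAddCommGroup F] [NormedSpace ℝ F] {s : Set E} (hs : Convex ℝ s) {f : E → F}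
    {f' : E → E →L[ℝ] F} {δ L M : ℝ} (hδ : 0 < δ)
    (hf : ∀ p ∈ s, δ / 2 ≤ ‖p‖ → HasFDerivAt f (f' p) p)
    (hL : ∀ p ∈ s, δ / 2 ≤ ‖p‖ → ‖f' p‖ ≤ L) (hM : ∀ p ∈ s, δ / 2 ≤ ‖p‖ → ‖f p‖ ≤ M) :
    ∃ K : NNReal, LipschitzOnWith K f {p | p ∈ s ∧ δ ≤ ‖p‖} := by
  refine ⟨(max L (4 * M / δ)).toNNReal, LipschitzOnWith.of_dist_le_mul ?_⟩
  rintro p ⟨hp, hpδ⟩ q ⟨hq, hqδ⟩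
  suffices h : dist (f p) (f q) ≤ max L (4 * M / δ) * dist p q from
    h.trans (mul_le_mul_of_nonneg_right (Real.le_coe_toNNReal _) dist_nonneg)
  -- For close points the segment stays in `s` and outside the ball of radius δ/2, so the mean value
  -- inequality applies. For distant points the bound 2M on the difference is enough.
  by_cases hpq : dist p q ≤ δ / 2
  · have hseg : ∀ z ∈ segment ℝ p q, z ∈ s ∧ δ / 2 ≤ ‖z‖ := by
      intro z hz
      refine ⟨hs.segment_subset hp hq hz, ?_⟩
      have h1 : dist z p ≤ dist q p :=
        (convex_closedBall p (dist q p)).segment_subset (by simp) (by simp) hz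
      have h2 : ‖p‖ ≤ ‖z‖ + dist z p := by
        rw [dist_comm, dist_eq_norm]
        linarith [norm_sub_norm_le p z]
      rw [dist_comm q p] at h1
      linarith
    have h := (convex_segment p q).norm_image_sub_le_of_norm_hasFDerivWithin_le
      (fun z hz => (hf z (hseg z hz).1 (hseg z hz).2).hasFDerivWithinAt)
      (fun z hz => hL z (hseg z hz).1 (hseg z hz).2)
      (right_mem_segment ℝ p q) (left_mem_segment ℝ p q)
    rw [dist_eq_norm, dist_eq_norm]
    exact h.trans (by gcongr; exact le_max_left _ _)
  · push Not at hpq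
    have h1 := hM p hp (by linarith)
    have h2 := hM q hq (by linarith)
    have hM0 : 0 ≤ M := (norm_nonneg _).trans h1
    calc dist (f p) (f q) ≤ ‖f p‖ + ‖f q‖ := by rw [dist_eq_norm]; exact norm_sub_le _ _
      _ ≤ 4 * M / δ * (δ / 2) := by field_simp; linarith
      _ ≤ max L (4 * M / δ) * dist p q := by
        gcongr
        exact le_max_right _ _

theorem exists_lipschitzOnWith_solution {ε : ℝ} (h0 : 0 < ε) (h1 : ε ≤ 1 / 4) {δ : ℝ}
    (hδ : 0 < δ) :
    ∃ K : NNReal, LipschitzOnWith K (solution ε) {p | p ∈ closedPast 2 ∧ δ ≤ ‖p‖} := by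
  have hδ2 : 0 < δ / 2 := by positivity
  have hw : 0 < min ((δ / 2) ^ 2) (δ / 2) := lt_min (by positivity) hδ2
  refine exists_lipschitzOnWith_of_bounds (convex_closedPast 2) hδ
    (fun p hp h => hasFDerivAt_solution ε (hw.trans_le (le_gauge_of_le_norm hδ2 hp h)))
    (fun p hp h => norm_fderiv_solution_le h0 h1 hw hp (le_gauge_of_le_norm hδ2 hp h))
    (M := 3 * min ((δ / 2) ^ 2) (δ / 2) ^ (-(ε / 2))) fun p hp h => ?_
  have hg := le_gauge_of_le_norm hδ2 hp h
  refine (norm_solution_le hp (hw.trans_le hg)).trans ?_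
  gcongr 3 * ?_
  exact Real.rpow_le_rpow_of_nonpos hw hg (by linarith)

/-! ### Discontinuity at the origin -/

theorem not_tendsto_solution {ε : ℝ} (h0 : 0 < ε) : ¬ ∃ L : EuclideanSpace ℝ (Fin 2),
    Tendsto (fun x => solution ε (x, (0 : ℝ))) (𝓝[≠] 0) (𝓝 L) := by
  rintro ⟨L, hL⟩
  set e : EuclideanSpace ℝ (Fin 2) := EuclideanSpace.single 0 1
  have he : ‖e‖ = 1 := by simp [e]
  have hray : Tendsto (fun l : ℝ => l • e) (𝓝[>] 0) (𝓝[≠] 0) := by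
    refine tendsto_nhdsWithin_iff.2 ⟨?_, ?_⟩
    · have h : Tendsto (fun l : ℝ => l • e) (𝓝 0) (𝓝 ((0 : ℝ) • e)) :=
        (continuous_id.smul continuous_const).tendsto 0
      rw [zero_smul] at h
      exact h.mono_left nhdsWithin_le_nhds
    · filter_upwards [self_mem_nhdsWithin] with l (hl : 0 < l)
      have : e ≠ 0 := norm_ne_zero_iff.1 (by rw [he]; exact one_ne_zero)
      exact smul_ne_zero hl.ne' this
  -- Along this ray the norm is l^{-ε}, which is unbounded as l → 0⁺.
  refine not_tendsto_nhds_of_tendsto_atTop (tendsto_rpow_neg_nhdsGT_zero (neg_lt_zero.2 h0)) ‖L‖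
    ((hL.norm.comp hray).congr' ?_)
  filter_upwards [self_mem_nhdsWithin] with l (hl : 0 < l)
  have h := solution_smul ε hl (p := (e, 0)) (show (0 : ℝ) ≤ 0 from le_rfl)
  rw [mul_zero] at h
  have h1 : solution ε (e, 0) = e := by simp [solution, decay, relTime, paraGauge, he]
  simp only [Function.comp, h, h1, norm_smul, he, mul_one, Real.norm_eq_abs]
  exact abs_of_pos (Real.rpow_pos_of_pos hl _)

theorem not_tendsto_coefficients {ε : ℝ} (h0 : 0 < ε) (h1 : ε ≤ 1 / 4) :
    ¬ ∃ L : Coeff 2 2, Tendsto (coefficients ε) (𝓝[past 2] (0, 0)) (𝓝 L) := by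
  rintro ⟨L, hL⟩
  have hray : ∀ x : EuclideanSpace ℝ (Fin 2), L = coefficients ε (x, -1) := by
    intro x
    have hcurve : Tendsto (fun l : ℝ => ((l • x, l ^ 2 * (-1)) : SpaceTime 2)) (𝓝[>] 0)
        (𝓝[past 2] (0, 0)) := by
      refine tendsto_nhdsWithin_iff.2 ⟨?_, ?_⟩
      · have hc : Continuous fun l : ℝ => ((l • x, l ^ 2 * (-1)) : SpaceTime 2) := by fun_prop
        have h := hc.tendsto 0
        simp only [zero_smul, ne_eq, OfNat.ofNat_ne_zero, not_false_eq_true, zero_pow,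
          zero_mul] at h
        exact h.mono_left nhdsWithin_le_nhds
      · filter_upwards [self_mem_nhdsWithin] with l (hl : 0 < l)
        change l ^ 2 * (-1) < 0
        nlinarith [pow_pos hl 2]
    refine tendsto_nhds_unique (hL.comp hcurve) (tendsto_const_nhds.congr' ?_)
    filter_upwards [self_mem_nhdsWithin] with l (hl : 0 < l)
    exact (coefficients_smul ε hl (x, -1)).symm
  -- The coefficients are constant along each parabola, so a limit would force the profile to be
  -- constant. The chosen entry contains no k and equals |P|² − P₁₀². At y = 0, P = 3I gives 18; at
  -- the unit vector, P = diag(−ε, 2) gives 4 + ε².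
  have h := congrFun (congrFun (congrFun (congrFun
    ((hray 0).symm.trans (hray (EuclideanSpace.single 0 1))) 1) 1) 0) 0
  simp [coefficients, pressureTensor, gradShape, relTime, paraGauge, Fin.sum_univ_two,
    Matrix.one_apply] at h
  have hε : ε ^ 2 = 14 := by
    norm_num at h
    linear_combination -h
  nlinarith

/-! ### The blow-up rate -/

/-- A continuous function is bounded at every point of an open set by its essential supremum. -/
theorem enorm_le_eLpNorm_top_of_isOpen {X F : Type*} [TopologicalSpace X] [MeasurableSpace X]
    [OpensMeasurableSpace X] [NormedAddCommGroup F] {μ : Measure X} [μ.IsOpenPosMeasure]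
    {s : Set X} (hs : IsOpen s) {f : X → F} (hf : ContinuousOn f s) {x : X} (hx : x ∈ s) :
    ‖f x‖ₑ ≤ eLpNorm f ⊤ (μ.restrict s) := by
  by_contra! h
  rw [eLpNorm_exponent_top] at h
  set M := eLpNormEssSup f (μ.restrict s)
  have hopen : IsOpen (s ∩ (fun y => ‖f y‖ₑ) ⁻¹' Ioi M) :=
    (continuous_enorm.comp_continuousOn hf).isOpen_inter_preimage hs isOpen_Ioi
  have hpos : 0 < μ (s ∩ (fun y => ‖f y‖ₑ) ⁻¹' Ioi M) := hopen.measure_pos μ ⟨x, hx, h⟩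
  have hae : ∀ᵐ y ∂μ.restrict s, ‖f y‖ₑ ≤ M := ae_le_eLpNormEssSup
  rw [ae_restrict_iff' hs.measurableSet] at hae
  refine hpos.ne' (measure_mono_null ?_ hae)
  rintro y ⟨hy, hyM⟩ hle
  exact absurd (hle hy) (not_le.2 hyM)

theorem blowup_solution {ε : ℝ} (h0 : 0 < ε) :
    ∃ c C : ℝ, 0 < c ∧ 0 < C ∧ ∀ t ∈ Ico (-1 : ℝ) 0,
      ENNReal.ofReal (c * (-t) ^ (-(ε / 2))) ≤
        eLpNorm (fun x => solution ε (x, t)) ⊤ (volume.restrict (Metric.ball 0 1)) ∧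
      eLpNorm (fun x => solution ε (x, t)) ⊤ (volume.restrict (Metric.ball 0 1)) ≤
        ENNReal.ofReal (C * (-t) ^ (-(ε / 2))) := by
  set y : EuclideanSpace ℝ (Fin 2) := (1 / 2 : ℝ) • EuclideanSpace.single 0 1
  have hy : ‖y‖ = 1 / 2 := by simp [y, norm_smul]
  have hc : 0 < ‖solution ε (y, -1)‖ := by
    have hg := gauge_pos (mk_neg_one_mem_past y)
    have hs := relTime_nonneg (past_subset_closedPast 2 (mk_neg_one_mem_past y))
    have hd : 0 < decay ε (y, -1) := Real.rpow_pos_of_pos hg _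
    rw [solution, norm_smul, hy, Real.norm_eq_abs, abs_of_nonneg (by positivity)]
    positivity
  refine ⟨‖solution ε (y, -1)‖, 3, hc, by norm_num, fun t ht => ⟨?_, ?_⟩⟩
  · have ht0 : 0 < -t := neg_pos.2 ht.2
    have hcont : ContinuousOn (fun x => solution ε (x, t)) (Metric.ball 0 1) :=
      (contDiffOn_solution ε).continuousOn.comp (by fun_prop)
        fun x _ => gauge_pos (show (x, t).2 < 0 from ht.2)
    -- The dilated point has norm at most 1/2, and there the solution equals (-t)^{-ε/2} times its
    -- value at (y, -1).
    have hmem : √(-t) • y ∈ Metric.ball (0 : EuclideanSpace ℝ (Fin 2)) 1 := by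
      have h1 : √(-t) ≤ 1 := Real.sqrt_le_one.2 (by linarith [ht.1])
      rw [mem_ball_zero_iff, norm_smul, hy, Real.norm_eq_abs, abs_of_nonneg (Real.sqrt_nonneg _)]
      linarith
    refine le_trans (le_of_eq ?_)
      (enorm_le_eLpNorm_top_of_isOpen (μ := volume) Metric.isOpen_ball hcont hmem)
    rw [solution_selfSimilar ε ht.2, inv_smul_smul₀ (Real.sqrt_pos.2 ht0).ne', ← ofReal_norm,
      norm_smul, Real.norm_eq_abs, abs_of_pos (Real.rpow_pos_of_pos ht0 _), mul_comm]
  · have hb : ∀ x, ‖solution ε (x, t)‖ ≤ 3 * (-t) ^ (-(ε / 2)) := by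
      intro x
      have hp : (x, t) ∈ past 2 := ht.2
      refine (norm_solution_le (past_subset_closedPast 2 hp) (gauge_pos hp)).trans ?_
      gcongr 3 * ?_
      refine Real.rpow_le_rpow_of_nonpos (neg_pos.2 ht.2) ?_ (by linarith)
      simp only [paraGauge]
      nlinarith [sq_nonneg ‖x‖]
    rw [eLpNorm_exponent_top]
    exact eLpNormEssSup_le_of_ae_bound (.of_forall hb)

/-! ### The range of exponents -/

theorem one_div_sq_mul_log_mem {R : ℝ} (hR : 3 ≤ R) :
    0 < 1 / (R ^ 2 * Real.log R) ∧ 1 / (R ^ 2 * Real.log R) ≤ 1 / 4 := by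
  have hlog : 1 ≤ Real.log R := by
    rw [Real.le_log_iff_exp_le (by linarith)]
    linarith [Real.exp_one_lt_d9]
  have h : 4 ≤ R ^ 2 * Real.log R := by nlinarith
  exact ⟨by positivity, one_div_le_one_div_of_le (by norm_num) h⟩

end ParabolicSystem

open ParabolicSystem in
theorem mainTheorem4 :
    ∃ Rstar : ℝ, 1 < Rstar ∧ ∀ R₀ : ℝ, Rstar ≤ R₀ → ∀ ε : ℝ, ε = 1 / (R₀ ^ 2 * Real.log R₀) →
    ∃ (U : EuclideanSpace ℝ (Fin 2) → EuclideanSpace ℝ (Fin 2))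
      (A : EuclideanSpace ℝ (Fin 2) → Coeff 2 2)
      (u : SpaceTime 2 → EuclideanSpace ℝ (Fin 2))
      (a : SpaceTime 2 → Coeff 2 2),
      -- the profile is smooth and bounded, its coefficients are smooth
      ContDiff ℝ ∞ U ∧ (∃ C : ℝ, ∀ y, ‖U y‖ ≤ C) ∧ ContDiff ℝ ∞ A ∧
      -- self-similar form of the solution and of the coefficients
      (∀ x : EuclideanSpace ℝ (Fin 2), ∀ t : ℝ, t < 0 →
        u (x, t) = ((-t) ^ (-(ε / 2)) : ℝ) • U ((√(-t))⁻¹ • x) ∧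
        a (x, t) = A ((√(-t))⁻¹ • x)) ∧
      -- `u` is smooth for `t < 0` and Lipschitz up to `t = 0` away from `(0, 0)`
      ContDiffOn ℝ ∞ u (past 2) ∧
      (∀ δ : ℝ, 0 < δ → ∃ K : NNReal, LipschitzOnWith K u {p | p ∈ closedPast 2 ∧ δ ≤ ‖p‖}) ∧
      -- `a` is symmetric, bounded, uniformly elliptic, and smooth for `t < 0`
      (∀ p ∈ closedPast 2, IsSymmCoeff (a p)) ∧
      (∃ C : ℝ, ∀ p ∈ closedPast 2, ‖a p‖ ≤ C) ∧
      UniformlyElliptic a (closedPast 2) ∧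
      ContDiffOn ℝ ∞ a (past 2) ∧
      -- `a` is essentially discontinuous at `(0, 0)`
      (¬ ∃ L : Coeff 2 2, Tendsto a (𝓝[past 2] (0, 0)) (𝓝 L)) ∧
      -- `u` solves the system
      IsWeakSolution a u ∧
      -- the `L^∞` norm on the unit ball blows up at the rate `(-t)^{-ε/2}`
      (∃ c C : ℝ, 0 < c ∧ 0 < C ∧ ∀ t ∈ Ico (-1 : ℝ) 0,
        ENNReal.ofReal (c * (-t) ^ (-(ε / 2))) ≤
          eLpNorm (fun x => u (x, t)) ⊤ (volume.restrict (Metric.ball 0 1)) ∧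
        eLpNorm (fun x => u (x, t)) ⊤ (volume.restrict (Metric.ball 0 1)) ≤
          ENNReal.ofReal (C * (-t) ^ (-(ε / 2)))) ∧
      -- `u(·, 0)` is homogeneous of degree `-ε`, and discontinuous at the origin
      (∀ x : EuclideanSpace ℝ (Fin 2), x ≠ 0 → ∀ s : ℝ, 0 < s →
        u (s • x, 0) = (s ^ (-ε) : ℝ) • u (x, 0)) ∧
      (¬ ∃ L : EuclideanSpace ℝ (Fin 2),
        Tendsto (fun x => u (x, (0 : ℝ))) (𝓝[≠] 0) (𝓝 L)) := by
  refine ⟨3, by norm_num, fun R₀ hR₀ ε hε => ?_⟩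
  obtain ⟨h0, h1⟩ : 0 < ε ∧ ε ≤ 1 / 4 := hε ▸ one_div_sq_mul_log_mem hR₀
  have hslice : ContDiff ℝ ∞ fun y : EuclideanSpace ℝ (Fin 2) => (y, (-1 : ℝ)) :=
    contDiff_id.prodMk contDiff_const
  have hu : ContDiffOn ℝ ∞ (solution ε) (past 2) :=
    (contDiffOn_solution ε).mono past_subset_gauge_pos
  have ha := contDiffOn_coefficients h0 h1
  refine ⟨fun y => solution ε (y, -1), fun y => coefficients ε (y, -1), solution ε,
    coefficients ε, hu.comp_contDiff hslice mk_neg_one_mem_past, ⟨3, fun y => ?_⟩,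
    ha.comp_contDiff hslice mk_neg_one_mem_past,
    fun x t ht => ⟨solution_selfSimilar ε ht x, coefficients_selfSimilar ε ht x⟩, hu,
    fun δ hδ => exists_lipschitzOnWith_solution h0 h1 hδ,
    fun p _ => isSymmCoeff_pressureTensor _ _, ⟨_, fun p hp => norm_coefficients_le h0 h1 hp⟩,
    uniformlyElliptic_coefficients h0 h1, ha, not_tendsto_coefficients h0 h1,
    isWeakSolution_solution h0 h1, blowup_solution h0, fun x _ s hs => ?_,
    not_tendsto_solution h0⟩
  · have hp := mk_neg_one_mem_past y
    refine (norm_solution_le (past_subset_closedPast 2 hp) (gauge_pos hp)).trans ?_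
    have h : paraGauge (y, -1) ^ (-(ε / 2)) ≤ 1 :=
      Real.rpow_le_one_of_one_le_of_nonpos (by simp [paraGauge]) (by linarith)
    linarith
  · have h := solution_smul ε hs (p := (x, 0)) (show (0 : ℝ) ≤ 0 from le_rfl)
    rwa [mul_zero] at h
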